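/- Let $(\Omega,\mathcal F,\mathbf P)$ be a probability space, let $L^\infty=L^\infty(\Omega,\mathcal F,\mathbf P)$ be the real Banach space of classes of essentially bounded measurable functions with the norm topology, and let $L^\infty_+=\{x\in L^\infty : x\ge 0 \text{ a.s.}\}$. The Kreps--Yan theorem is valid for the ordered space $(L^\infty,L^\infty_+)$ with the norm topology. That is: $L^\infty_+$ is a norm closed convex cone with $L^\infty_+\cap(-L^\infty_+)=\{0\}$ which admits a strictly positive functional, and for every norm closed convex cone $C\subset L^\infty$ with $-L^\infty_+\subset C$ and $C\cap L^\infty_+=\{0\}$ there is a continuous linear functional $\mu\in(L^\infty)^*$ which is strictly positive, i.e. $\langle x,\mu\rangle>0$ for all $x\in L^\infty_+\setminus\{0\}$, and satisfies $\langle x,\mu\rangle\le 0$ for all $x\in C$. -/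

import Mathlib

open MeasureTheory
open scoped ENNReal Pointwise

section KrepsYan

variable {X : Type*} [AddCommGroup X] [Module ℝ X] [TopologicalSpace X]

/-- A continuous linear functional is strictly positive with respect to the cone `K`
if it is positive at every nonzero element of `K`. -/
def IsStrictlyPositiveOn (K : ConvexCone ℝ X) (ξ : StrongDual ℝ X) : Prop :=
  ∀ x ∈ K, x ≠ 0 → 0 < ξ x

/-- The cones that are admitted as positive cones of an ordered space `(X, K)`: closed convex
cones with `K ∩ (-K) = {0}` which possess at least one strictly positive functional. -/
structure IsOrderingCone (K : ConvexCone ℝ X) : Prop where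
  isClosed : IsClosed (K : Set X)
  inter_neg : (K : Set X) ∩ -(K : Set X) = {0}
  exists_strictlyPositive : ∃ ξ : StrongDual ℝ X, IsStrictlyPositiveOn K ξ

/-- Validity of the Kreps–Yan theorem for the ordered space `(X, K)` with the given topology
of `X`. The topology being compatible with a duality `⟨X, Y⟩` means that `Y` is the space of
continuous linear functionals on `X`, so the elements of `Y` are taken in `StrongDual ℝ X`. -/
def KrepsYanValid (K : ConvexCone ℝ X) : Prop :=
  ∀ C : ConvexCone ℝ X, IsClosed (C : Set X) → -(K : Set X) ⊆ (C : Set X) →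
    (C : Set X) ∩ (K : Set X) = {0} →
    ∃ ξ : StrongDual ℝ X, IsStrictlyPositiveOn K ξ ∧ ∀ x ∈ C, ξ x ≤ 0

end KrepsYan

/-- The cone of almost everywhere nonnegative elements of `L^∞`. -/
def LinftyPos {Ω : Type*} [MeasurableSpace Ω] (P : Measure Ω) : ConvexCone ℝ (Lp ℝ ∞ P) where
  carrier := {x | ∀ᵐ ω ∂P, 0 ≤ x ω}
  smul_mem' := by
    intro c hc x hx
    filter_upwards [hx, Lp.coeFn_smul c x] with ω h1 h2
    rw [h2]
    exact mul_nonneg hc.le h1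
  add_mem' := by
    intro x hx y hy
    filter_upwards [hx, hy, Lp.coeFn_add x y] with ω h1 h2 h3
    rw [h3]
    exact add_nonneg h1 h2

/-!
Fix a norm closed convex cone `C` with `-L^∞_+ ⊆ C` and `C ∩ L^∞_+ = {0}`. For `ε > 0` let `K_ε` be
the convex set of all `x ∈ L^∞` with `0 ≤ x ≤ 1` and `∫ x ≥ ε`. The heart of the proof is that `K_ε`
has positive norm distance from `C` (`exists_pos_forall_sub_const_notMem`).

Indeed, otherwise the convex sets `D_n = {x ∈ K_ε : x - 1/(n+1) ∈ C}` are nonempty and decreasing,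
and near-minimal elements of them for the `L²` norm converge in `L²`
(`exists_seq_mem_tendsto_of_antitone`), hence along a subsequence almost everywhere. By Egorov's
theorem the convergence to the limit `k` is uniform off a set `t` of measure at most `ε / 2`. Since
the elements of `D_n` are nonnegative on `t` and `C` is downward closed, `k 1_{tᶜ} - δ ∈ C` for every
`δ > 0`, so the nonnegative `k 1_{tᶜ}` belongs to the norm closed cone `C` and vanishes. Then the
elements far out in the sequence are uniformly small off `t`, and their integral is less than `ε`:
a contradiction.

By Hahn–Banach there is then, for each `ε`, a functional that is nonpositive on `C` and strictly
positive on `K_ε`. Every nonzero element of `L^∞_+` has a positive multiple in some `K_{1/(n+1)}`, so a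
summable positive combination of countably many of these functionals is strictly positive. Applied
to `C = -L^∞_+`, this also provides a strictly positive functional on `L^∞_+`.
-/

open Filter Topology

/-! ### Decreasing convex sets in a Hilbert space -/

/-- Elements of almost minimal norm form a Cauchy sequence, by the parallelogram law. -/
theorem exists_seq_mem_tendsto_of_antitone {H : Type*} [NormedAddCommGroup H]
    [InnerProductSpace ℝ H] [CompleteSpace H] {D : ℕ → Set H} (hanti : Antitone D)
    (hconv : ∀ n, Convex ℝ (D n)) (hne : ∀ n, (D n).Nonempty)
    (hbdd : Bornology.IsBounded (D 0)) :
    ∃ (x : ℕ → H) (l : H), (∀ n, x n ∈ D n) ∧ Tendsto x atTop (𝓝 l) := by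
  set d : ℕ → ℝ := fun n ↦ Metric.infDist 0 (D n)
  have hmono : Monotone d := fun m n hmn ↦
    Metric.infDist_le_infDist_of_subset (hanti hmn) (hne n)
  obtain ⟨R, hR⟩ := hbdd.exists_norm_le
  have hub : ∀ n, d n ≤ R := fun n ↦ by
    obtain ⟨y, hy⟩ := hne n
    refine (Metric.infDist_le_dist_of_mem hy).trans ?_
    simpa using hR y (hanti (Nat.zero_le n) hy)
  have hbdd' : BddAbove (Set.range d) := ⟨R, by rintro _ ⟨n, rfl⟩; exact hub n⟩
  have htend : Tendsto d atTop (𝓝 (⨆ n, d n)) := tendsto_atTop_ciSup hmono hbdd'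
  set s := ⨆ n, d n
  have hds : ∀ n, d n ≤ s := fun n ↦ le_ciSup hbdd' n
  have hd0 : ∀ n, 0 ≤ d n := fun n ↦ Metric.infDist_nonneg
  have hex : ∀ n : ℕ, ∃ y ∈ D n, ‖y‖ < d n + 1 / ((n : ℝ) + 1) := fun n ↦ by
    have h : Metric.infDist 0 (D n) < d n + 1 / ((n : ℝ) + 1) :=
      lt_add_of_pos_right _ Nat.one_div_pos_of_nat
    obtain ⟨y, hy, hlt⟩ := (Metric.infDist_lt_iff (hne n)).1 h
    exact ⟨y, hy, by simpa using hlt⟩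
  choose x hx hxn using hex
  have hcauchy : CauchySeq x := by
    refine cauchySeq_of_le_tendsto_0'
      (fun m : ℕ ↦ √(4 * (s + 1 / ((m : ℝ) + 1)) ^ 2 - 4 * d m ^ 2)) ?_ ?_
    · intro m n hmn
      rw [dist_eq_norm]
      apply Real.le_sqrt_of_sq_le
      have hmid : (1 / 2 : ℝ) • x m + (1 / 2 : ℝ) • x n ∈ D m :=
        hconv m (hx m) (hanti hmn (hx n)) (by norm_num) (by norm_num) (by norm_num)
      have h1 : d m ≤ ‖x m + x n‖ / 2 := by
        have := Metric.infDist_le_dist_of_mem (x := (0 : H)) hmid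
        rw [dist_zero_left, ← smul_add, norm_smul] at this
        norm_num at this
        linarith
      have h2 := parallelogram_law_with_norm ℝ (x m) (x n)
      have hmn' : 1 / ((n : ℝ) + 1) ≤ 1 / ((m : ℝ) + 1) := Nat.one_div_le_one_div hmn
      have h3 : ‖x m‖ ^ 2 ≤ (s + 1 / ((m : ℝ) + 1)) ^ 2 :=
        pow_le_pow_left₀ (norm_nonneg _) (by linarith [hxn m, hds m]) 2
      have h4 : ‖x n‖ ^ 2 ≤ (s + 1 / ((m : ℝ) + 1)) ^ 2 :=
        pow_le_pow_left₀ (norm_nonneg _) (by linarith [hxn n, hds n]) 2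
      have h5 : d m ^ 2 ≤ (‖x m + x n‖ / 2) ^ 2 := pow_le_pow_left₀ (hd0 m) h1 2
      linarith
    · have h : Tendsto (fun m : ℕ ↦ √(4 * (s + 1 / ((m : ℝ) + 1)) ^ 2 - 4 * d m ^ 2)) atTop
          (𝓝 √(4 * (s + 0) ^ 2 - 4 * s ^ 2)) :=
        ((((tendsto_one_div_add_atTop_nhds_zero_nat.const_add s).pow 2).const_mul 4).sub
          ((htend.pow 2).const_mul 4)).sqrt
      simpa using h
  obtain ⟨l, hl⟩ := cauchySeq_tendsto_of_complete hcauchy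
  exact ⟨x, l, hx, hl⟩

/-! ### Almost everywhere inequalities and constants in `L^∞` -/

section Linfty

variable {Ω : Type*} [MeasurableSpace Ω] {P : Measure Ω}

theorem mem_linftyPos_iff {x : Lp ℝ ∞ P} : x ∈ LinftyPos P ↔ 0 ≤ x :=
  Lp.coeFn_nonneg x

theorem coe_linftyPos : (LinftyPos P : Set (Lp ℝ ∞ P)) = Set.Ici 0 :=
  Set.ext fun _ ↦ mem_linftyPos_iff

theorem zero_mem_linftyPos : (0 : Lp ℝ ∞ P) ∈ LinftyPos P :=
  mem_linftyPos_iff.2 le_rfl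

/-- A cone containing `-L^∞_+` is downward closed. -/
theorem mem_of_ae_le {C : ConvexCone ℝ (Lp ℝ ∞ P)}
    (hneg : -(LinftyPos P : Set (Lp ℝ ∞ P)) ⊆ C) {x y : Lp ℝ ∞ P} (hy : y ∈ C)
    (hxy : ∀ᵐ ω ∂P, x ω ≤ y ω) : x ∈ C := by
  have h : x - y ∈ C := hneg <| by
    rw [Set.mem_neg, neg_sub]
    exact mem_linftyPos_iff.2 (sub_nonneg.2 ((Lp.coeFn_le x y).1 hxy))
  simpa using C.add_mem h hy

theorem ae_norm_le_norm (x : Lp ℝ ∞ P) : ∀ᵐ ω ∂P, ‖x ω‖ ≤ ‖x‖ := by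
  filter_upwards [ae_le_eLpNormEssSup (f := x) (μ := P)] with ω hω
  rw [Lp.norm_def, eLpNorm_exponent_top, ← toReal_enorm]
  exact ENNReal.toReal_mono (by simpa using Lp.eLpNorm_ne_top x) hω

variable [IsProbabilityMeasure P]

theorem integrable_of_linfty (x : Lp ℝ ∞ P) : Integrable x P :=
  (Lp.memLp x).integrable le_top

theorem coeFn_sub_const (x : Lp ℝ ∞ P) (c : ℝ) :
    ∀ᵐ ω ∂P, (x - Lp.const ∞ P c) ω = x ω - c := by
  filter_upwards [Lp.coeFn_sub x (Lp.const ∞ P c), Lp.coeFn_const ∞ P c] with ω h1 h2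
  rw [h1, Pi.sub_apply, h2, Function.const_apply]

theorem mem_of_forall_sub_const_mem {C : Set (Lp ℝ ∞ P)} (hC : IsClosed C) {z : Lp ℝ ∞ P}
    (h : ∀ δ : ℝ, 0 < δ → z - Lp.const ∞ P δ ∈ C) : z ∈ C := by
  have hlim : Tendsto (fun n : ℕ ↦ z - Lp.constL ∞ P ℝ (1 / ((n : ℝ) + 1))) atTop
      (𝓝 (z - Lp.constL ∞ P ℝ (0 : ℝ))) :=
    ((Lp.constL ∞ P ℝ).continuous.tendsto 0 |>.comp
      tendsto_one_div_add_atTop_nhds_zero_nat).const_sub z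
  rw [map_zero, sub_zero] at hlim
  exact hC.mem_of_tendsto hlim (Eventually.of_forall fun n ↦ h _ Nat.one_div_pos_of_nat)

/-! ### The sets `K_ε` and their distance from the cone -/

/-- The set `K_ε` of all `x ∈ L^∞` with `0 ≤ x ≤ 1` almost everywhere and `∫ x ≥ ε`. -/
def unitIntervalWithIntegralGE (P : Measure Ω) (ε : ℝ) : Set (Lp ℝ ∞ P) :=
  {x | (∀ᵐ ω ∂P, 0 ≤ x ω) ∧ (∀ᵐ ω ∂P, x ω ≤ 1) ∧ ε ≤ ∫ ω, x ω ∂P}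

theorem convex_unitIntervalWithIntegralGE (ε : ℝ) :
    Convex ℝ (unitIntervalWithIntegralGE P ε) := by
  rintro x ⟨hx0, hx1, hxi⟩ y ⟨hy0, hy1, hyi⟩ a b ha hb hab
  have hae : ∀ᵐ ω ∂P, (a • x + b • y) ω = a * x ω + b * y ω := by
    filter_upwards [Lp.coeFn_add (a • x) (b • y), Lp.coeFn_smul a x, Lp.coeFn_smul b y]
      with ω h1 h2 h3
    rw [h1, Pi.add_apply, h2, h3]
    rfl
  refine ⟨?_, ?_, ?_⟩
  · filter_upwards [hae, hx0, hy0] with ω h h1 h2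
    rw [h]
    positivity
  · filter_upwards [hae, hx1, hy1] with ω h h1 h2
    rw [h]
    nlinarith
  · rw [integral_congr_ae hae, integral_add ((integrable_of_linfty x).const_mul a)
      ((integrable_of_linfty y).const_mul b), integral_const_mul, integral_const_mul]
    calc ε = a * ε + b * ε := by rw [← add_mul, hab, one_mul]
      _ ≤ _ := by gcongr

/-- If constants tending to `0` could be subtracted from elements of `K_ε` so as to land in `C`, then
elements with this property could be chosen convergent almost everywhere. -/
theorem exists_seq_ae_tendsto {C : ConvexCone ℝ (Lp ℝ ∞ P)}
    (hneg : -(LinftyPos P : Set (Lp ℝ ∞ P)) ⊆ C) {ε : ℝ}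
    (h : ∀ d : ℝ, 0 < d → ∃ x ∈ unitIntervalWithIntegralGE P ε, x - Lp.const ∞ P d ∈ C) :
    ∃ (x : ℕ → Lp ℝ ∞ P) (l : Lp ℝ 2 P),
      (∀ n, x n ∈ unitIntervalWithIntegralGE P ε) ∧
      (∀ n : ℕ, x n - Lp.const ∞ P (1 / ((n : ℝ) + 1)) ∈ C) ∧
      ∀ᵐ ω ∂P, Tendsto (fun n ↦ x n ω) atTop (𝓝 (l ω)) := by
  let D : ℕ → Set (Lp ℝ 2 P) := fun n ↦ {y | ∃ x ∈ unitIntervalWithIntegralGE P ε,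
    x - Lp.const ∞ P (1 / ((n : ℝ) + 1)) ∈ C ∧ y =ᵐ[P] x}
  -- A smaller constant may be replaced by a larger one because `C` is downward closed.
  have hmono : ∀ {m n : ℕ} {x : Lp ℝ ∞ P}, m ≤ n → x - Lp.const ∞ P (1 / ((n : ℝ) + 1)) ∈ C →
      x - Lp.const ∞ P (1 / ((m : ℝ) + 1)) ∈ C := by
    intro m n x hmn hx
    refine mem_of_ae_le hneg hx ?_
    have hmn' : 1 / ((n : ℝ) + 1) ≤ 1 / ((m : ℝ) + 1) := Nat.one_div_le_one_div hmn
    filter_upwards [coeFn_sub_const x (1 / ((n : ℝ) + 1)),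
      coeFn_sub_const x (1 / ((m : ℝ) + 1))] with ω h1 h2
    rw [h1, h2]
    linarith
  have hanti : Antitone D := by
    rintro m n hmn y ⟨x, hx, hxC, hyx⟩
    exact ⟨x, hx, hmono hmn hxC, hyx⟩
  have hconv : ∀ n, Convex ℝ (D n) := by
    rintro n y₁ ⟨x₁, hx₁, hC₁, h₁⟩ y₂ ⟨x₂, hx₂, hC₂, h₂⟩ a b ha hb hab
    refine ⟨a • x₁ + b • x₂, convex_unitIntervalWithIntegralGE ε hx₁ hx₂ ha hb hab, ?_, ?_⟩
    · suffices heq : a • x₁ + b • x₂ - Lp.const ∞ P (1 / ((n : ℝ) + 1)) =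
          a • (x₁ - Lp.const ∞ P (1 / ((n : ℝ) + 1))) +
            b • (x₂ - Lp.const ∞ P (1 / ((n : ℝ) + 1))) by
        rw [heq]
        exact C.convex hC₁ hC₂ ha hb hab
      rw [smul_sub, smul_sub, sub_add_sub_comm, ← add_smul, hab, one_smul]
    · filter_upwards [h₁, h₂, Lp.coeFn_add (a • x₁) (b • x₂), Lp.coeFn_smul a x₁,
        Lp.coeFn_smul b x₂, Lp.coeFn_add (a • y₁) (b • y₂), Lp.coeFn_smul a y₁,
        Lp.coeFn_smul b y₂] with ω e1 e2 e3 e4 e5 e6 e7 e8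
      rw [e3, e6, Pi.add_apply, Pi.add_apply, e4, e5, e7, e8, Pi.smul_apply, Pi.smul_apply,
        Pi.smul_apply, Pi.smul_apply, e1, e2]
  have hne : ∀ n, (D n).Nonempty := by
    intro n
    obtain ⟨x, hx, hxC⟩ := h (1 / ((n : ℝ) + 1)) Nat.one_div_pos_of_nat
    exact ⟨((Lp.memLp x).mono_exponent le_top).toLp x, x, hx, hxC, MemLp.coeFn_toLp _⟩
  have hbdd : Bornology.IsBounded (D 0) := by
    refine isBounded_iff_forall_norm_le.2 ⟨(measureUnivNNReal P : ℝ) ^ (2 : ℝ≥0∞).toReal⁻¹ * 1, ?_⟩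
    rintro y ⟨x, ⟨hx0, hx1, -⟩, -, hyx⟩
    refine Lp.norm_le_of_ae_bound zero_le_one ?_
    filter_upwards [hx0, hx1, hyx] with ω h0 h1 h2
    rw [h2, Real.norm_eq_abs, abs_of_nonneg h0]
    exact h1
  obtain ⟨y, l, hy, hl⟩ := exists_seq_mem_tendsto_of_antitone hanti hconv hne hbdd
  obtain ⟨φ, hφ, hφl⟩ := (tendstoInMeasure_of_tendsto_Lp hl).exists_seq_tendsto_ae
  choose x hx hxC hyx using hy
  refine ⟨fun n ↦ x (φ n), l, fun n ↦ hx _, fun n ↦ hmono (hφ.id_le n) (hxC _), ?_⟩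
  filter_upwards [hφl, ae_all_iff.2 hyx] with ω h1 h2
  simpa only [h2] using h1

/-- The set `K_ε` has positive distance from `C`, expressed through the constants: no element of
`K_ε` lies in `C` after subtraction of the constant `d`. -/
theorem exists_pos_forall_sub_const_notMem {C : ConvexCone ℝ (Lp ℝ ∞ P)}
    (hC : IsClosed (C : Set (Lp ℝ ∞ P))) (hneg : -(LinftyPos P : Set (Lp ℝ ∞ P)) ⊆ C)
    (hinter : (C : Set (Lp ℝ ∞ P)) ∩ LinftyPos P = {0}) {ε : ℝ} (hε : 0 < ε) :
    ∃ d : ℝ, 0 < d ∧ ∀ x ∈ unitIntervalWithIntegralGE P ε, x - Lp.const ∞ P d ∉ C := by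
  by_contra! hcon
  obtain ⟨x, l, hx, hxC, hlim⟩ := exists_seq_ae_tendsto hneg hcon
  have hl01 : ∀ᵐ ω ∂P, 0 ≤ l ω ∧ l ω ≤ 1 := by
    filter_upwards [hlim, ae_all_iff.2 fun n ↦ (hx n).1, ae_all_iff.2 fun n ↦ (hx n).2.1]
      with ω h h0 h1
    exact ⟨ge_of_tendsto' h h0, le_of_tendsto' h h1⟩
  obtain ⟨t, ht, htε, hunif⟩ := tendstoUniformlyOn_of_ae_tendsto'
    (fun n ↦ Lp.stronglyMeasurable (x n)) (Lp.stronglyMeasurable l) hlim (half_pos hε)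
  have hmem : MemLp (tᶜ.indicator l) ∞ P := by
    refine memLp_top_of_bound
      ((Lp.stronglyMeasurable l).indicator ht.compl).aestronglyMeasurable 1 ?_
    filter_upwards [hl01] with ω h
    by_cases hω : ω ∈ t
    · simp [hω]
    · simp [hω, abs_of_nonneg h.1, h.2]
  set z : Lp ℝ ∞ P := hmem.toLp _
  have hzae : z =ᵐ[P] tᶜ.indicator l := hmem.coeFn_toLp
  have hzC : z ∈ C := by
    refine mem_of_forall_sub_const_mem hC fun δ hδ ↦ ?_
    obtain ⟨n, hn1, hn2⟩ := ((Metric.tendstoUniformlyOn_iff.1 hunif (δ / 2) (half_pos hδ)).and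
      (tendsto_one_div_add_atTop_nhds_zero_nat.eventually_lt_const (half_pos hδ))).exists
    refine mem_of_ae_le hneg (hxC n) ?_
    filter_upwards [coeFn_sub_const z δ, coeFn_sub_const (x n) (1 / ((n : ℝ) + 1)), hzae,
      (hx n).1] with ω h1 h2 h3 h4
    rw [h1, h2, h3]
    by_cases hω : ω ∈ t
    · simp only [Set.mem_compl_iff, hω, not_true_eq_false, not_false_eq_true,
        Set.indicator_of_notMem]
      linarith
    · have h5 := hn1 ω hω
      rw [Real.dist_eq, abs_lt] at h5
      rw [Set.indicator_of_mem (Set.mem_compl hω)]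
      linarith [h5.2]
  have hzpos : z ∈ LinftyPos P := by
    change ∀ᵐ ω ∂P, 0 ≤ z ω
    filter_upwards [hzae, hl01] with ω h1 h2
    rw [h1]
    exact Set.indicator_apply_nonneg fun _ ↦ h2.1
  have hz0 : z = 0 := by
    have : z ∈ (C : Set (Lp ℝ ∞ P)) ∩ LinftyPos P := ⟨hzC, hzpos⟩
    rwa [hinter] at this
  have hl0 : ∀ᵐ ω ∂P, ω ∉ t → l ω = 0 := by
    have h0 : ∀ᵐ ω ∂P, z ω = 0 := by
      rw [hz0]
      exact Lp.coeFn_zero ℝ ∞ P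
    filter_upwards [hzae, h0] with ω h1 h2 hω
    rw [h2, Set.indicator_of_mem (Set.mem_compl hω)] at h1
    exact h1.symm
  obtain ⟨n, hn⟩ := (Metric.tendstoUniformlyOn_iff.1 hunif (ε / 4) (by positivity)).exists
  have hle : ∀ᵐ ω ∂P, x n ω ≤ t.indicator (fun _ ↦ (1 : ℝ)) ω + ε / 4 := by
    filter_upwards [hl0, (hx n).2.1] with ω h1 h2
    by_cases hω : ω ∈ t
    · rw [Set.indicator_of_mem hω]
      linarith
    · have h5 := hn ω hω
      rw [Real.dist_eq, h1 hω, abs_lt] at h5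
      rw [Set.indicator_of_notMem hω]
      linarith [h5.1]
  have hint : Integrable (t.indicator fun _ ↦ (1 : ℝ)) P := (integrable_const 1).indicator ht
  have h1 : ∫ ω, x n ω ∂P ≤ P.real t + ε / 4 := by
    refine (integral_mono_ae (integrable_of_linfty _) (hint.add (integrable_const _)) hle).trans ?_
    rw [integral_add' hint (integrable_const _), integral_indicator_const _ ht]
    simp
  have h2 : P.real t ≤ ε / 2 := ENNReal.toReal_le_of_le_ofReal (by positivity) htε
  linarith [(hx n).2.2]

/-! ### Separating functionals and their combination -/

/-- For each `ε > 0`, some continuous functional is nonpositive on `C` and strictly positive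
on `K_ε`. -/
theorem exists_dual_pos_on_unitIntervalWithIntegralGE {C : ConvexCone ℝ (Lp ℝ ∞ P)}
    (hC : IsClosed (C : Set (Lp ℝ ∞ P))) (hneg : -(LinftyPos P : Set (Lp ℝ ∞ P)) ⊆ C)
    (hinter : (C : Set (Lp ℝ ∞ P)) ∩ LinftyPos P = {0}) {ε : ℝ} (hε : 0 < ε) :
    ∃ ξ : StrongDual ℝ (Lp ℝ ∞ P), (∀ x ∈ C, ξ x ≤ 0) ∧
      ∀ x ∈ unitIntervalWithIntegralGE P ε, 0 < ξ x := by
  obtain ⟨d, hd, hdC⟩ := exists_pos_forall_sub_const_notMem hC hneg hinter hε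
  have hdisj : Disjoint (unitIntervalWithIntegralGE P ε + Metric.ball 0 d)
      (C : Set (Lp ℝ ∞ P)) := by
    rw [Set.disjoint_left]
    rintro _ ⟨x, hx, b, hb, rfl⟩ hxb
    refine hdC x hx (mem_of_ae_le hneg hxb ?_)
    filter_upwards [ae_norm_le_norm b, coeFn_sub_const x d, Lp.coeFn_add x b] with ω h1 h2 h3
    rw [h2, h3, Pi.add_apply]
    have h4 : ‖b‖ < d := by simpa using hb
    rw [Real.norm_eq_abs] at h1
    linarith [neg_le_of_abs_le h1]
  obtain ⟨f, u, hfu, huf⟩ := geometric_hahn_banach_open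
    ((convex_unitIntervalWithIntegralGE ε).add (convex_ball 0 d)) Metric.isOpen_ball.add_left
    C.convex hdisj
  have h0C : (0 : Lp ℝ ∞ P) ∈ C :=
    hneg (by simpa using (zero_mem_linftyPos : (0 : Lp ℝ ∞ P) ∈ LinftyPos P))
  have hu : u ≤ 0 := by simpa using huf 0 h0C
  refine ⟨-f, fun x hx ↦ ?_, fun x hx ↦ ?_⟩
  · -- A linear functional bounded below on a cone is nonnegative there.
    by_contra! hlt
    have hfx : f x < 0 := by simpa using hlt
    have hc : 0 < (u - 1) / f x := div_pos_of_neg_of_neg (by linarith) hfx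
    have := huf _ (C.smul_mem hc hx)
    rw [map_smul, smul_eq_mul, div_mul_cancel₀ _ hfx.ne] at this
    linarith
  · have := hfu _ (Set.add_mem_add hx (Metric.mem_ball_self hd))
    rw [add_zero] at this
    change 0 < -f x
    linarith

/-- Every nonzero element of `L^∞_+` has a positive multiple in some `K_{1/(n+1)}`. -/
theorem exists_smul_mem_unitIntervalWithIntegralGE {x : Lp ℝ ∞ P} (hx : x ∈ LinftyPos P)
    (hx0 : x ≠ 0) :
    ∃ (c : ℝ) (n : ℕ), 0 < c ∧ c • x ∈ unitIntervalWithIntegralGE P (1 / ((n : ℝ) + 1)) := by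
  have hx' : ∀ᵐ ω ∂P, 0 ≤ x ω := hx
  have hpos : 0 < ∫ ω, x ω ∂P := by
    refine lt_of_le_of_ne (integral_nonneg_of_ae hx') fun h ↦ hx0 ?_
    exact (Lp.eq_zero_iff_ae_eq_zero).2
      ((integral_eq_zero_iff_of_nonneg_ae hx' (integrable_of_linfty x)).1 h.symm)
  have hnorm : 0 < ‖x‖ := norm_pos_iff.2 hx0
  have hsmul : ∀ᵐ ω ∂P, (‖x‖⁻¹ • x) ω = ‖x‖⁻¹ * x ω := Lp.coeFn_smul _ x
  obtain ⟨n, hn⟩ := exists_nat_one_div_lt (mul_pos (inv_pos.2 hnorm) hpos)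
  refine ⟨‖x‖⁻¹, n, inv_pos.2 hnorm, ?_, ?_, ?_⟩
  · filter_upwards [hsmul, hx'] with ω h1 h2
    rw [h1]
    positivity
  · filter_upwards [hsmul, ae_norm_le_norm x] with ω h1 h2
    rw [h1, inv_mul_le_iff₀ hnorm, mul_one]
    exact (le_abs_self _).trans h2
  · rw [integral_congr_ae hsmul, integral_const_mul]
    exact hn.le

theorem krepsYanValid_linftyPos (P : Measure Ω) [IsProbabilityMeasure P] :
    KrepsYanValid (LinftyPos P) := by
  intro C hC hneg hinter
  choose ξ hξC hξpos using fun n : ℕ ↦ exists_dual_pos_on_unitIntervalWithIntegralGE hC hneg hinter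
    (ε := 1 / ((n : ℝ) + 1)) Nat.one_div_pos_of_nat
  set a : ℕ → ℝ := fun n ↦ (1 / 2) ^ n / (‖ξ n‖ + 1) with ha
  have hapos : ∀ n, 0 < a n := fun n ↦ by positivity
  have hsum : Summable fun n ↦ a n • ξ n := by
    refine Summable.of_norm_bounded summable_geometric_two fun n ↦ ?_
    rw [norm_smul, Real.norm_of_nonneg (hapos n).le, ha, div_mul_eq_mul_div,
      div_le_iff₀ (by positivity)]
    gcongr
    linarith
  have happly : ∀ x, HasSum (fun n ↦ a n * ξ n x) ((∑' n, a n • ξ n) x) := fun x ↦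
    hsum.hasSum.mapL (ContinuousLinearMap.apply ℝ ℝ x)
  refine ⟨∑' n, a n • ξ n, fun x hx hx0 ↦ ?_, fun x hx ↦ ?_⟩
  · have hnonneg : ∀ n, 0 ≤ ξ n x := fun n ↦ by
      have := hξC n (-x) (hneg (by simpa using hx))
      rw [map_neg] at this
      linarith
    obtain ⟨c, n, hc, hcx⟩ := exists_smul_mem_unitIntervalWithIntegralGE hx hx0
    have hn : 0 < ξ n x := by
      have := hξpos n _ hcx
      rw [map_smul, smul_eq_mul] at this
      exact pos_of_mul_pos_right this hc.le
    rw [← (happly x).tsum_eq]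
    exact (happly x).summable.tsum_pos (fun m ↦ mul_nonneg (hapos m).le (hnonneg m)) n
      (mul_pos (hapos n) hn)
  · exact hasSum_le (fun n ↦ mul_nonpos_of_nonneg_of_nonpos (hapos n).le (hξC n x hx))
      (happly x) hasSum_zero

theorem isOrderingCone_linftyPos (P : Measure Ω) [IsProbabilityMeasure P] :
    IsOrderingCone (LinftyPos P) := by
  have hclosed : IsClosed (LinftyPos P : Set (Lp ℝ ∞ P)) := by
    rw [coe_linftyPos]
    exact isClosed_Ici
  have hinter : (LinftyPos P : Set (Lp ℝ ∞ P)) ∩ -(LinftyPos P : Set (Lp ℝ ∞ P)) = {0} := by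
    ext x
    simp only [coe_linftyPos, Set.mem_inter_iff, Set.mem_Ici, Set.mem_neg, neg_nonneg,
      Set.mem_singleton_iff]
    exact ⟨fun h ↦ le_antisymm h.2 h.1, fun h ↦ by simp [h]⟩
  have hcoe : ((LinftyPos P).comap (-LinearMap.id) : Set (Lp ℝ ∞ P)) =
      -(LinftyPos P : Set (Lp ℝ ∞ P)) := rfl
  obtain ⟨ξ, hξ, -⟩ := krepsYanValid_linftyPos P ((LinftyPos P).comap (-LinearMap.id))
    (by rw [hcoe]; exact hclosed.neg) hcoe.ge (by rw [hcoe, Set.inter_comm]; exact hinter)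
  exact ⟨hclosed, hinter, ξ, hξ⟩

end Linfty

theorem theorem2 {Ω : Type*} [MeasurableSpace Ω] (P : Measure Ω) [IsProbabilityMeasure P] :
    IsOrderingCone (LinftyPos P) ∧ KrepsYanValid (LinftyPos P) :=
  ⟨isOrderingCone_linftyPos P, krepsYanValid_linftyPos P⟩
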